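/- Let $q$ be a power of an odd prime, let $t\ge 5$ and $n=2t$, and let $\sigma$ be a generator of the cyclic group $\mathrm{Gal}(\mathbb{F}_{q^n}/\mathbb{F}_q)$. Let $\mathcal{L}_{n,q}$ be the ring of $\sigma$-polynomials $\sum_{i=0}^{n-1}f_i x^{\sigma^i}$, $f_i\in\mathbb{F}_{q^n}$, with the usual addition and with multiplication given by composition, $(a x^{\sigma^i})\circ(b x^{\sigma^j})=a\,\sigma^i(b)\,x^{\sigma^{i+j}}$ (up to isomorphism it does not depend on the generator, and it is isomorphic to $\mathrm{End}_{\mathbb{F}_q}(\mathbb{F}_{q^n})$). Two subsets $\mathcal{C}_1,\mathcal{C}_2\subseteq\mathcal{L}_{n,q}$ are called equivalent if there are invertible $f_1,f_2\in\mathcal{L}_{n,q}$ and $\rho\in\mathrm{Aut}(\mathbb{F}_{q^n})$ with $\mathcal{C}_1=\{f_1\circ g^\rho\circ f_2 : g\in\mathcal{C}_2\}$, where $g^\rho$ is obtained from $g$ by applying $\rho$ to all coefficients. For a generator $\theta$ of $\mathrm{Gal}(\mathbb{F}_{q^n}/\mathbb{F}_q)$ and $h\in\mathbb{F}_{q^n}^*$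 put $$\psi_{h,t,\theta}(x)=x^{\theta}+x^{\theta^{t-1}}+h\,\theta(h)\,x^{\theta^{t+1}}+h\,\theta^{-1}(h^{-1})\,x^{\theta^{2t-1}},\qquad \mathcal{C}_{h,t,\theta}=\langle x,\psi_{h,t,\theta}(x)\rangle_{\mathbb{F}_{q^n}}.$$ Let $h,k\in\mathbb{F}_{q^n}$ satisfy $\sigma^t(h)h=\sigma^t(k)k=-1$. For $a,b\in\mathbb{F}_{q^n}$ write $a\sim b$ if either $t\not\equiv 2\pmod 4$ and $a=\pm b$, or $t\equiv 2\pmod 4$ and $a=lb$ for some $l\in\mathbb{F}_{q^n}$ with $l^{q^2+1}=1$. Then the following hold. I. $\mathcal{C}_{h,t,\sigma}$ and $\mathcal{C}_{k,t,\sigma}$ are equivalent if and only if there is $\rho\in\mathrm{Aut}(\mathbb{F}_{q^n})$ with $\rho(h)\sim k$. II. $\mathcal{C}_{h,t,\sigma}$ and $\mathcal{C}_{k,t,\sigma^{-1}}$ are equivalent if and only if there is $\rho\in\mathrm{Aut}(\mathbb{F}_{q^n})$ with $\rho(h)\sim k^{-1}$. III. If $t$ is even, then $\mathcal{C}_{h,t,\sigma}$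 and $\mathcal{C}_{k,t,\sigma^{t-1}}$ are equivalent if and only if there is $\rho\in\mathrm{Aut}(\mathbb{F}_{q^n})$ with $\rho(h)\sim k$. IV. If $t$ is even, then $\mathcal{C}_{h,t,\sigma}$ and $\mathcal{C}_{k,t,\sigma^{t+1}}$ are equivalent if and only if there is $\rho\in\mathrm{Aut}(\mathbb{F}_{q^n})$ with $\rho(h)\sim k^{-1}$. -/

import Mathlib

noncomputable section

namespace RankMetric

variable {F K : Type*} [Field F] [Field K] [Algebra F K]

variable (F K) in
/-- The ring of `σ`-polynomials of the extension `K / F`: formal sums `∑ f_τ x^τ` with coefficients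
`f_τ ∈ K` and exponents `τ ∈ Gal(K / F)`. Addition is coefficientwise, and multiplication is the
composition `(a x^τ) ∘ (b x^υ) = a τ(b) x^(τ υ)`. For a cyclic Galois group generated by `σ` the
elements are the sums `∑ f_i x^(σ^i)`, `0 ≤ i < n`, whatever the generator. -/
abbrev SigmaPoly : Type _ := SkewMonoidAlgebra K (K ≃ₐ[F] K)

/-- The monomial `a x^τ`. -/
def monomial (τ : K ≃ₐ[F] K) (a : K) : SigmaPoly F K := SkewMonoidAlgebra.single τ a

/-- `g ↦ g^ρ`: apply a field automorphism `ρ` of `K` (not necessarily fixing `F`) to every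
coefficient of `g`. -/
def twist (ρ : K ≃+* K) (g : SigmaPoly F K) : SigmaPoly F K :=
  SkewMonoidAlgebra.ofCoeff (g.coeff.mapRange ρ (map_zero ρ))

/-- Equivalence of rank-metric codes `C₁, C₂`, that is, of sets of `σ`-polynomials:
`C₁ = {f₁ ∘ g^ρ ∘ f₂ : g ∈ C₂}` with `f₁, f₂` invertible and `ρ` a field automorphism of `K`. -/
def CodeEquiv (C₁ C₂ : Set (SigmaPoly F K)) : Prop :=
  ∃ f₁ f₂ : SigmaPoly F K, IsUnit f₁ ∧ IsUnit f₂ ∧ ∃ ρ : K ≃+* K,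
    C₁ = {f | ∃ g ∈ C₂, f = f₁ * twist ρ g * f₂}

/-- `ψ_{h,t,σ}(x) = x^σ + x^(σ^(t-1)) + h σ(h) x^(σ^(t+1)) + h σ⁻¹(h⁻¹) x^(σ^(2t-1))`. -/
def psi (h : K) (t : ℕ) (σ : K ≃ₐ[F] K) : SigmaPoly F K :=
  monomial σ 1 + monomial (σ ^ ((t : ℤ) - 1)) 1 + monomial (σ ^ ((t : ℤ) + 1)) (h * σ h)
    + monomial (σ ^ (2 * (t : ℤ) - 1)) (h * σ⁻¹ h⁻¹)

/-- `C_{h,t,σ}`: the `K`-subspace spanned by `x` and `ψ_{h,t,σ}(x)`, scalars acting on the left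
(on the coefficients). -/
def code (h : K) (t : ℕ) (σ : K ≃ₐ[F] K) : Set (SigmaPoly F K) :=
  (Submodule.span K {monomial 1 1, psi h t σ} : Submodule K (SigmaPoly F K))

/-- `a = ± b` if `t ≢ 2 (mod 4)`, and `a = l b` for some `l` with `l^(q²+1) = 1` if
`t ≡ 2 (mod 4)`. -/
def EqUpToFactor (q t : ℕ) (a b : K) : Prop :=
  (¬ t ≡ 2 [MOD 4] → a = b ∨ a = -b) ∧
  (t ≡ 2 [MOD 4] → ∃ l : K, l ^ (q ^ 2 + 1) = 1 ∧ a = l * b)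

end RankMetric

end

/-! Any equivalence with `code h t σ` reduces to a right translation. The left idealiser of ⟨x, ψ_h⟩
is the field of scalars (`eq_monomial_of_mul_mem_spanCode`), so the left factor f₁ normalises K and
is a monomial (`eq_monomial_of_normalizes`). Since the Galois group is abelian, its exponent can be
absorbed into ρ and f₂, and its coefficient into the code. This gives
`exists_rightEquiv_of_codeEquiv`.

For each of the four generators θ, the code of k is a right translate of ⟨x, ψ_m^{ε,δ}⟩ with m = k
or m = k⁻¹ and suitable signs: substituting θ only permutes the exponents ±1, t±1.

Necessity: if ⟨x, ψ_h⟩ = ⟨x, ψ_m^{ε,δ}⟩ ∘ u, then u = a + bψ_h. Comparing coefficients of ψ_m^{ε,δ}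
∘ u yields σ²(l) l = 1 for l = h/m, whatever the signs (`mul_eq_mul_of_rightEquiv`). Together with
σ^t(l) l = 1 this is exactly the relation ∼ (`eqUpToFactor_iff`).

Sufficiency: a factor l with these two properties is removed by a right scalar (`rightEquiv_mul`).
Signs are changed by scalars a with σ(a) = -a or σ²(a) = -a, and for even t also by a translation
that exchanges the two generators up to scalars (`rightEquiv_neg_one_one_of_even`). `codeEquiv_iff`
combines both directions. -/

noncomputable section

namespace RankMetric

variable {F K : Type*} [Field F] [Field K] [Algebra F K]

/-! ### Monomials -/

lemma monomial_mul_monomial (τ υ : K ≃ₐ[F] K) (a b : K) :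
    monomial τ a * monomial υ b = monomial (τ * υ) (a * τ b) :=
  SkewMonoidAlgebra.single_mul_single

lemma monomial_add (τ : K ≃ₐ[F] K) (a b : K) :
    monomial τ (a + b) = monomial τ a + monomial τ b :=
  SkewMonoidAlgebra.single_add τ a b

lemma monomial_zero (τ : K ≃ₐ[F] K) : monomial τ (0 : K) = 0 :=
  SkewMonoidAlgebra.single_zero τ

lemma monomial_one_one : monomial (1 : K ≃ₐ[F] K) (1 : K) = 1 := rfl

lemma coeff_monomial_self (τ : K ≃ₐ[F] K) (a : K) : (monomial τ a).coeff τ = a := by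
  simp [monomial]

lemma coeff_monomial_of_ne {τ υ : K ≃ₐ[F] K} (h : τ ≠ υ) (a : K) :
    (monomial τ a).coeff υ = 0 := by
  simp [monomial, h]

lemma smul_eq_monomial_mul (c : K) (f : SigmaPoly F K) : c • f = monomial 1 c * f := by
  induction f using SkewMonoidAlgebra.induction_on with
  | zero => simp
  | single τ a =>
    rw [SkewMonoidAlgebra.smul_single]
    change _ = monomial 1 c * monomial τ a
    rw [monomial_mul_monomial, one_mul, AlgEquiv.one_apply]
    rfl
  | add f g hf hg => rw [smul_add, hf, hg, mul_add]

lemma coeff_monomial_one_mul (c : K) (f : SigmaPoly F K) (τ : K ≃ₐ[F] K) :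
    (monomial 1 c * f).coeff τ = c * f.coeff τ := by
  rw [← smul_eq_monomial_mul, SkewMonoidAlgebra.coeff_smul, Finsupp.smul_apply, smul_eq_mul]

lemma coeff_mul_monomial_one (f : SigmaPoly F K) (c : K) (τ : K ≃ₐ[F] K) :
    (f * monomial 1 c).coeff τ = f.coeff τ * τ c := by
  induction f using SkewMonoidAlgebra.induction_on with
  | zero => simp
  | single υ a =>
    change (monomial υ a * monomial 1 c).coeff τ = (monomial υ a).coeff τ * τ c
    rw [monomial_mul_monomial, mul_one]
    by_cases h : υ = τ
    · subst h; simp only [coeff_monomial_self]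
    · simp only [coeff_monomial_of_ne h, zero_mul]
  | add f g hf hg => simp only [add_mul, SkewMonoidAlgebra.coeff_add, Finsupp.add_apply, hf, hg]

lemma isUnit_monomial (τ : K ≃ₐ[F] K) {a : K} (ha : a ≠ 0) : IsUnit (monomial τ a) := by
  refine isUnit_iff_exists.mpr ⟨monomial τ⁻¹ (τ⁻¹ a⁻¹), ?_, ?_⟩
  all_goals
    rw [monomial_mul_monomial]
    simp only [mul_inv_cancel, inv_mul_cancel, ← AlgEquiv.mul_apply, AlgEquiv.one_apply]
    try rw [← map_mul]
    simp [ha, monomial_one_one]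

lemma twist_add (ρ : K ≃+* K) (f g : SigmaPoly F K) :
    twist ρ (f + g) = twist ρ f + twist ρ g := by
  ext τ; simp [twist]

lemma twist_monomial (ρ : K ≃+* K) (τ : K ≃ₐ[F] K) (a : K) :
    twist ρ (monomial τ a) = monomial τ (ρ a) := by
  simp [twist, monomial]

/-! ### Equivalence by a unit factor on the right -/

/-- `C₁ = C₂ ∘ u` for an invertible `u`. -/
def RightEquiv (C₁ C₂ : Set (SigmaPoly F K)) : Prop :=
  ∃ u : SigmaPoly F K, IsUnit u ∧ C₁ = (· * u) '' C₂

lemma RightEquiv.refl (C : Set (SigmaPoly F K)) : RightEquiv C C :=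
  ⟨1, isUnit_one, by simp⟩

lemma RightEquiv.symm {C₁ C₂ : Set (SigmaPoly F K)} (h : RightEquiv C₁ C₂) :
    RightEquiv C₂ C₁ := by
  obtain ⟨_, ⟨u, rfl⟩, rfl⟩ := h
  refine ⟨↑u⁻¹, Units.isUnit _, ?_⟩
  rw [Set.image_image]
  simp [mul_assoc]

lemma RightEquiv.trans {C₁ C₂ C₃ : Set (SigmaPoly F K)} (h : RightEquiv C₁ C₂)
    (h' : RightEquiv C₂ C₃) : RightEquiv C₁ C₃ := by
  obtain ⟨u, hu, rfl⟩ := h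
  obtain ⟨v, hv, rfl⟩ := h'
  refine ⟨v * u, hv.mul hu, ?_⟩
  rw [Set.image_image]
  simp [mul_assoc]

lemma RightEquiv.codeEquiv {C₁ C₂ : Set (SigmaPoly F K)} {ρ : K ≃+* K}
    (h : RightEquiv C₁ (twist ρ '' C₂)) : CodeEquiv C₁ C₂ := by
  obtain ⟨u, hu, rfl⟩ := h
  refine ⟨1, u, isUnit_one, hu, ρ, ?_⟩
  ext f
  simp [eq_comm]

/-- The code `⟨x, P⟩` spanned by `x` and a `σ`-polynomial `P`. -/
def spanCode (P : SigmaPoly F K) : Set (SigmaPoly F K) :=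
  {f | ∃ c d : K, f = monomial 1 c + monomial 1 d * P}

lemma code_eq_spanCode (h : K) (t : ℕ) (σ : K ≃ₐ[F] K) : code h t σ = spanCode (psi h t σ) := by
  ext f
  simp only [code, SetLike.mem_coe, Submodule.mem_span_pair, spanCode, Set.mem_ofPred_eq,
    smul_eq_monomial_mul, monomial_mul_monomial]
  simp [eq_comm]

lemma rightEquiv_spanCode_of_scalar {P Q : SigmaPoly F K} {a d : K} (ha : a ≠ 0) (hd : d ≠ 0)
    (h : P * monomial 1 a = monomial 1 d * Q) : RightEquiv (spanCode Q) (spanCode P) := by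
  refine ⟨monomial 1 a, isUnit_monomial 1 ha, ?_⟩
  ext f
  simp only [spanCode, Set.mem_ofPred_eq, Set.mem_image]
  constructor
  · rintro ⟨x, y, rfl⟩
    refine ⟨_, ⟨x / a, y / d, rfl⟩, ?_⟩
    rw [add_mul, mul_assoc, h, ← mul_assoc]
    simp [monomial_mul_monomial, ha, hd]
  · rintro ⟨_, ⟨x, y, rfl⟩, rfl⟩
    refine ⟨x * a, y * d, ?_⟩
    rw [add_mul, mul_assoc, h, ← mul_assoc]
    simp [monomial_mul_monomial]

/-- In a finite ring a one-sided inverse is two-sided; this is what makes the translating factor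
below a unit. -/
instance [Finite K] [FiniteDimensional F K] : Finite (SigmaPoly F K) :=
  Finite.of_injective (fun f τ ↦ f.coeff τ) fun f g h ↦ by
    ext τ; exact congrFun h τ

/-- Right multiplication by bQ sends x to bQ and P to cx, so it exchanges the roles of the two
generators. -/
lemma rightEquiv_spanCode_of_inverse [Finite K] [FiniteDimensional F K]
    {P Q : SigmaPoly F K} {b c : K} (hb : b ≠ 0) (hc : c ≠ 0)
    (h : P * (monomial 1 b * Q) = monomial 1 c) : RightEquiv (spanCode Q) (spanCode P) := by
  have hu : IsUnit (monomial 1 b * Q) := by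
    have : monomial 1 c⁻¹ * P * (monomial 1 b * Q) = 1 := by
      rw [mul_assoc, h, monomial_mul_monomial]; simp [hc, monomial_one_one]
    exact IsUnit.of_mul_eq_one_right _ this
  refine ⟨_, hu, ?_⟩
  ext f
  simp only [spanCode, Set.mem_ofPred_eq, Set.mem_image]
  constructor
  · rintro ⟨x, y, rfl⟩
    refine ⟨_, ⟨y / b, x / c, rfl⟩, ?_⟩
    rw [add_mul, mul_assoc, h, ← mul_assoc]
    simp [monomial_mul_monomial, hb, hc, add_comm]
  · rintro ⟨_, ⟨x, y, rfl⟩, rfl⟩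
    refine ⟨y * c, x * b, ?_⟩
    rw [add_mul, mul_assoc, h, ← mul_assoc]
    simp [monomial_mul_monomial, add_comm]

/-! ### Quadrinomials -/

section Quad

variable (σ : K ≃ₐ[F] K) (t : ℕ)

/-- `α x^σ + β x^(σ^(t-1)) + γ x^(σ^(t+1)) + δ x^(σ⁻¹)`. -/
def quad (α β γ δ : K) : SigmaPoly F K :=
  monomial (σ ^ (1 : ℤ)) α + monomial (σ ^ ((t : ℤ) - 1)) β + monomial (σ ^ ((t : ℤ) + 1)) γ
    + monomial (σ ^ (-1 : ℤ)) δ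

lemma quad_mul_monomial (α β γ δ a : K) :
    quad σ t α β γ δ * monomial 1 a =
      quad σ t (α * (σ ^ (1 : ℤ)) a) (β * (σ ^ ((t : ℤ) - 1)) a) (γ * (σ ^ ((t : ℤ) + 1)) a)
        (δ * (σ ^ (-1 : ℤ)) a) := by
  simp only [quad, add_mul, monomial_mul_monomial, mul_one]

lemma monomial_mul_quad (α β γ δ a : K) :
    monomial 1 a * quad σ t α β γ δ = quad σ t (a * α) (a * β) (a * γ) (a * δ) := by
  simp only [quad, mul_add, monomial_mul_monomial, one_mul, AlgEquiv.one_apply]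

/-- A sum of monomials with exponents `σ^0, σ^2, σ^(t+2), σ^t, σ^(t-2), σ^(-2)`. -/
def hexa (p q r s u v : K) : SigmaPoly F K :=
  monomial 1 p + monomial (σ ^ (2 : ℤ)) q + monomial (σ ^ ((t : ℤ) + 2)) r
    + monomial (σ ^ (t : ℤ)) s + monomial (σ ^ ((t : ℤ) - 2)) u + monomial (σ ^ (-2 : ℤ)) v

variable {σ t}

lemma zpow_congr_of_order (hσ : orderOf σ = 2 * t) {i j : ℤ} (k : ℤ) (h : i = j + k * (2 * t)) :
    σ ^ i = σ ^ j := by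
  rw [zpow_eq_zpow_iff_modEq, hσ, h]
  simp

lemma quad_mul_quad (hσ : orderOf σ = 2 * t) (α β γ δ α' β' γ' δ' : K) :
    quad σ t α β γ δ * quad σ t α' β' γ' δ' = hexa σ t
      (α * (σ ^ (1 : ℤ)) δ' + δ * (σ ^ (-1 : ℤ)) α' + β * (σ ^ ((t : ℤ) - 1)) γ'
        + γ * (σ ^ ((t : ℤ) + 1)) β')
      (α * (σ ^ (1 : ℤ)) α' + γ * (σ ^ ((t : ℤ) + 1)) γ')
      (α * (σ ^ (1 : ℤ)) γ' + γ * (σ ^ ((t : ℤ) + 1)) α')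
      (α * (σ ^ (1 : ℤ)) β' + β * (σ ^ ((t : ℤ) - 1)) α' + γ * (σ ^ ((t : ℤ) + 1)) δ'
        + δ * (σ ^ (-1 : ℤ)) γ')
      (β * (σ ^ ((t : ℤ) - 1)) δ' + δ * (σ ^ (-1 : ℤ)) β')
      (β * (σ ^ ((t : ℤ) - 1)) β' + δ * (σ ^ (-1 : ℤ)) δ') := by
  have e1 : σ ^ ((t : ℤ) - 1 + (t + 1)) = 1 := by
    rw [← zpow_zero σ]; exact zpow_congr_of_order hσ 1 (by ring)
  have e2 : σ ^ ((t : ℤ) + 1 + (t - 1)) = 1 := by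
    rw [← zpow_zero σ]; exact zpow_congr_of_order hσ 1 (by ring)
  have e3 : σ ^ ((t : ℤ) + 1 + (t + 1)) = σ ^ (2 : ℤ) := zpow_congr_of_order hσ 1 (by ring)
  have e4 : σ ^ ((t : ℤ) - 1 + (t - 1)) = σ ^ (-2 : ℤ) := zpow_congr_of_order hσ 1 (by ring)
  have e5 : (1 : ℤ) + 1 = 2 := rfl
  have e6 : (1 : ℤ) + -1 = 0 := rfl
  have e7 : (-1 : ℤ) + 1 = 0 := rfl
  have e8 : (-1 : ℤ) + -1 = -2 := rfl
  have e9 : (1 : ℤ) + (t - 1) = t := by ring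
  have e10 : (1 : ℤ) + (t + 1) = t + 2 := by ring
  have e11 : (t : ℤ) - 1 + 1 = t := by ring
  have e12 : (t : ℤ) - 1 + -1 = t - 2 := by ring
  have e13 : (t : ℤ) + 1 + 1 = t + 2 := by ring
  have e14 : (t : ℤ) + 1 + -1 = t := by ring
  have e15 : (-1 : ℤ) + (t - 1) = t - 2 := by ring
  have e16 : (-1 : ℤ) + (t + 1) = t := by ring
  simp only [quad, hexa, add_mul, mul_add, monomial_mul_monomial, ← zpow_add, e1, e2, e3, e4, e5,
    e6, e7, e8, e9, e10, e11, e12, e13, e14, e15, e16, monomial_add, zpow_zero]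
  abel

lemma coeff_monomial_zpow_of_ne (hσ : orderOf σ = 2 * t) {i j : ℤ} (a : K)
    (hij : i ≠ j) (h₁ : -(2 * t) < i - j) (h₂ : i - j < 2 * t) :
    (monomial (σ ^ i) a).coeff (σ ^ j) = 0 := by
  refine coeff_monomial_of_ne (fun e ↦ hij ?_) a
  rw [zpow_eq_zpow_iff_modEq, hσ, Int.modEq_comm, Int.modEq_iff_dvd] at e
  have := Int.eq_zero_of_abs_lt_dvd e (by rw [abs_lt]; push_cast; omega)
  omega

/-- For t ≥ 5 the exponents 0, ±1, ±2, t, t±1, t±2 are distinct modulo 2t, so coefficients can be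
compared one by one. -/
lemma quad_add_hexa_eq (hσ : orderOf σ = 2 * t) (ht : 5 ≤ t)
    {α β γ δ p q r s u v c α' β' γ' δ' : K}
    (h : quad σ t α β γ δ + hexa σ t p q r s u v = monomial 1 c + quad σ t α' β' γ' δ') :
    α = α' ∧ β = β' ∧ γ = γ' ∧ δ = δ' ∧ q = 0 ∧ r = 0 ∧ s = 0 ∧ u = 0 ∧ v = 0 := by
  have key (j : ℤ) := congrArg (fun f ↦ f.coeff (σ ^ j)) h
  have h1 (x : K) : monomial 1 x = monomial (σ ^ (0 : ℤ)) x := by rw [zpow_zero]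
  simp only [quad, hexa, SkewMonoidAlgebra.coeff_add, Finsupp.add_apply, h1] at key
  refine ⟨?_, ?_, ?_, ?_, ?_, ?_, ?_, ?_, ?_⟩
  · simpa (disch := omega) only [coeff_monomial_self, coeff_monomial_zpow_of_ne hσ, add_zero,
      zero_add] using key 1
  · simpa (disch := omega) only [coeff_monomial_self, coeff_monomial_zpow_of_ne hσ, add_zero,
      zero_add] using key (t - 1)
  · simpa (disch := omega) only [coeff_monomial_self, coeff_monomial_zpow_of_ne hσ, add_zero,
      zero_add] using key (t + 1)
  · simpa (disch := omega) only [coeff_monomial_self, coeff_monomial_zpow_of_ne hσ, add_zero,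
      zero_add] using key (-1)
  · simpa (disch := omega) only [coeff_monomial_self, coeff_monomial_zpow_of_ne hσ, add_zero,
      zero_add] using key 2
  · simpa (disch := omega) only [coeff_monomial_self, coeff_monomial_zpow_of_ne hσ, add_zero,
      zero_add] using key (t + 2)
  · simpa (disch := omega) only [coeff_monomial_self, coeff_monomial_zpow_of_ne hσ, add_zero,
      zero_add] using key t
  · simpa (disch := omega) only [coeff_monomial_self, coeff_monomial_zpow_of_ne hσ, add_zero,
      zero_add] using key (t - 2)
  · simpa (disch := omega) only [coeff_monomial_self, coeff_monomial_zpow_of_ne hσ, add_zero,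
      zero_add] using key (-2)

end Quad

/-! ### The signed quadrinomials `ψ_m^{ε,δ}` -/

section Signed

variable (σ : K ≃ₐ[F] K) (t : ℕ)

/-- `x^σ + ε x^(σ^(t-1)) + ε δ m σ(m) x^(σ^(t+1)) + δ m σ⁻¹(m)⁻¹ x^(σ⁻¹)`. -/
def signedPsi (ε δ m : K) : SigmaPoly F K :=
  quad σ t 1 ε (ε * δ * (m * (σ ^ (1 : ℤ)) m)) (δ * (m / (σ ^ (-1 : ℤ)) m))

variable {σ t}

lemma zpow_apply_zpow_apply (i j : ℤ) (x : K) : (σ ^ i) ((σ ^ j) x) = (σ ^ (i + j)) x := by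
  rw [zpow_add, AlgEquiv.mul_apply]

lemma zpow_t_add_apply {m : K} (hm : (σ ^ t) m * m = -1) (i : ℤ) :
    (σ ^ ((t : ℤ) + i)) m = -((σ ^ i) m)⁻¹ := by
  have h0 : m ≠ 0 := by rintro rfl; simp at hm
  have : (σ ^ (t : ℤ)) m = -m⁻¹ := by
    rw [zpow_natCast]; field_simp; exact hm
  rw [add_comm, ← zpow_apply_zpow_apply, this, map_neg, map_inv₀]

lemma apply_eq_of_sign {ε : K} (hε : ε = 1 ∨ ε = -1) (τ : K ≃ₐ[F] K) : τ ε = ε := by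
  rcases hε with rfl | rfl <;> simp

lemma one_mem_spanCode (P : SigmaPoly F K) : 1 ∈ spanCode P :=
  ⟨1, 0, by simp [monomial_zero, monomial_one_one]⟩

lemma self_mem_spanCode (P : SigmaPoly F K) : P ∈ spanCode P :=
  ⟨0, 1, by simp [monomial_zero, monomial_one_one]⟩

/-- The left idealiser of `⟨x, ψ_h⟩` is the field of scalars. -/
lemma eq_monomial_of_mul_mem_spanCode (hσ : orderOf σ = 2 * t) (ht : 5 ≤ t) (h2 : (2 : K) ≠ 0)
    {h : K} (hh : (σ ^ t) h * h = -1) {g : SigmaPoly F K}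
    (hg : ∀ f ∈ spanCode (signedPsi σ t 1 1 h), g * f ∈ spanCode (signedPsi σ t 1 1 h)) :
    ∃ c, g = monomial 1 c := by
  have h0 : h ≠ 0 := by rintro rfl; simp at hh
  obtain ⟨a, b, hgab⟩ := hg 1 (one_mem_spanCode _)
  obtain ⟨c, d, e⟩ := hg _ (self_mem_spanCode _)
  rw [mul_one] at hgab
  by_cases hb : b = 0
  · exact ⟨a, by rw [hgab, hb, monomial_zero, zero_mul, add_zero]⟩
  exfalso
  rw [hgab, add_mul] at e
  unfold signedPsi at e
  simp only [monomial_mul_quad] at e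
  rw [quad_mul_quad hσ] at e
  -- The coefficient at σ² gives σ²(h) = -h and the one at σ^t gives h² = -1. The latter forces σ(h)
  -- = ±h, hence σ²(h) = h, a contradiction in odd characteristic.
  obtain ⟨-, -, -, -, eq, -, es, -, -⟩ := quad_add_hexa_eq hσ ht e
  have hT := zpow_t_add_apply hh
  have ht0 : (σ ^ (t : ℤ)) h = -h⁻¹ := by simpa using hT 0
  simp only [map_mul, map_one, one_mul, mul_one, map_div₀, zpow_apply_zpow_apply, hT,
    add_assoc, Int.reduceAdd, Int.reduceNeg, zpow_zero, AlgEquiv.one_apply] at eq es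
  have n1 : (σ ^ (1 : ℤ)) h ≠ 0 := by simpa using h0
  have n2 : (σ ^ (2 : ℤ)) h ≠ 0 := by simpa using h0
  have nm : (σ ^ (-1 : ℤ)) h ≠ 0 := by simpa using h0
  have e2 : (σ ^ (2 : ℤ)) h = - h := by
    field_simp at eq
    refine mul_left_cancel₀ hb ?_
    linear_combination eq
  have es' : h ^ 2 = -1 := by
    field_simp at es
    have : b * 2 * (h ^ 2 + 1) = 0 := by linear_combination es
    have := (mul_eq_zero.mp this).resolve_left (mul_ne_zero hb h2)
    linear_combination this
  have e1 : (σ ^ (1 : ℤ)) h ^ 2 = h ^ 2 := by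
    rw [← map_pow, es', map_neg, map_one]
  have e3 : (σ ^ (2 : ℤ)) h = (σ ^ (1 : ℤ)) ((σ ^ (1 : ℤ)) h) := by
    rw [zpow_apply_zpow_apply]; rfl
  have e4 : (σ ^ (2 : ℤ)) h = h := by
    rcases sq_eq_sq_iff_eq_or_eq_neg.mp e1 with e | e
    · rw [e3, e, e]
    · rw [e3, e, map_neg, e, neg_neg]
  have : 2 * h = 0 := by linear_combination e2 - e4
  exact (mul_ne_zero h2 h0) this

/-- If `⟨x, ψ_h⟩` is a right translate of `⟨x, ψ_m^{ε,δ}⟩`, then `h / m` is inverted by `σ²`. -/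
lemma mul_eq_mul_of_rightEquiv (hσ : orderOf σ = 2 * t) (ht : 5 ≤ t)
    {h m ε δ : K} (hh : (σ ^ t) h * h = -1) (hm0 : m ≠ 0)
    (hε : ε = 1 ∨ ε = -1) (hδ : δ = 1 ∨ δ = -1)
    (H : RightEquiv (spanCode (signedPsi σ t 1 1 h)) (spanCode (signedPsi σ t ε δ m))) :
    (σ ^ (1 : ℤ)) h * (σ ^ (-1 : ℤ)) h = (σ ^ (1 : ℤ)) m * (σ ^ (-1 : ℤ)) m := by
  have h0 : h ≠ 0 := by rintro rfl; simp at hh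
  have hε2 : ε ^ 2 = 1 := by rcases hε with rfl | rfl <;> ring
  have hδ2 : δ ^ 2 = 1 := by rcases hδ with rfl | rfl <;> ring
  obtain ⟨u, hu, H⟩ := H
  obtain ⟨a, b, hab⟩ : u ∈ spanCode (signedPsi σ t 1 1 h) := by
    rw [H]; exact ⟨1, one_mem_spanCode _, one_mul u⟩
  obtain ⟨c, d, e⟩ : signedPsi σ t ε δ m * u ∈ spanCode (signedPsi σ t 1 1 h) := by
    rw [H]; exact ⟨_, self_mem_spanCode _, rfl⟩
  rw [hab, mul_add] at e
  unfold signedPsi at e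
  simp only [monomial_mul_quad] at e
  rw [quad_mul_quad hσ, quad_mul_monomial] at e
  obtain ⟨e1, e2, e3, e4, eq, -, -, -, ev⟩ := quad_add_hexa_eq hσ ht e
  have hT := zpow_t_add_apply hh
  have n1 : (σ ^ (1 : ℤ)) h ≠ 0 := by simpa using h0
  have nm : (σ ^ (-1 : ℤ)) h ≠ 0 := by simpa using h0
  have mm : (σ ^ (-1 : ℤ)) m ≠ 0 := by simpa using hm0
  have c1 : (1 : ℤ) + -1 = 0 := rfl
  have c2 : (-1 : ℤ) + 1 = 0 := rfl
  have c3 : (-1 : ℤ) + (t + 1) = t := by ring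
  have c4 : (1 : ℤ) + (t - 1) = t := by ring
  by_cases hb : b = 0
  · have ha : a ≠ 0 := by
      rintro rfl
      simp [hb, monomial_zero] at hab
      exact hu.ne_zero hab
    have n2 : (σ ^ (2 : ℤ)) a ≠ 0 := by simpa using ha
    rw [one_mul, mul_one] at e1
    subst e1
    -- After these shifts the three equations involve only a, σ²(a) and σ^t(a), which can then be
    -- eliminated.
    replace e2 := congrArg (σ ^ (1 : ℤ)) e2
    replace e3 := congrArg (σ ^ (-1 : ℤ)) e3
    replace e4 := congrArg (σ ^ (1 : ℤ)) e4
    simp only [map_mul, one_mul, mul_one, map_div₀, zpow_apply_zpow_apply,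
      apply_eq_of_sign hε, apply_eq_of_sign hδ, c1, c2, c3, c4, zpow_zero, AlgEquiv.one_apply,
      show (1 : ℤ) + 1 = 2 from rfl] at e2 e3 e4
    field_simp at e4
    refine mul_left_cancel₀ (mul_ne_zero (mul_ne_zero n2 hm0) h0) ?_
    linear_combination -((σ ^ (-1 : ℤ)) h * h) * e4 - (δ * (σ ^ (1 : ℤ)) m * h) *
      (e3 - δ * (σ ^ (-1 : ℤ)) m * m * e2) +
      (σ ^ (1 : ℤ)) m * h * (σ ^ (-1 : ℤ)) m * m * (σ ^ (2 : ℤ)) a * hδ2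
  -- The coefficients at σ² and σ⁻², shifted by σ⁻¹ and σ, are two linear relations between b and
  -- σ^t(b). Eliminating σ^t(b) leaves the claim times b h.
  · replace eq := congrArg (σ ^ (-1 : ℤ)) eq
    replace ev := congrArg (σ ^ (1 : ℤ)) ev
    simp only [map_add, map_zero, map_mul, one_mul, mul_one, map_div₀, map_inv₀, map_neg,
      zpow_apply_zpow_apply, add_assoc, hT,
      apply_eq_of_sign hε, apply_eq_of_sign hδ, c1, c2, c3, c4, zpow_zero, AlgEquiv.one_apply,
      show (1 : ℤ) + 1 = 2 from rfl, show (-1 : ℤ) + 2 = 1 from rfl,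
      show (1 : ℤ) + (-1 + -1) = -1 from rfl] at eq ev
    field_simp at eq ev
    refine mul_left_cancel₀ (mul_ne_zero hb h0) ?_
    linear_combination (σ ^ (-1 : ℤ)) h * eq - δ * (σ ^ (-1 : ℤ)) m * ev +
      b * h * (σ ^ (1 : ℤ)) m * (σ ^ (-1 : ℤ)) m * hδ2

end Signed

/-! ### Field automorphisms -/

lemma pow_apply_of_apply_eq_inv {τ : K ≃ₐ[F] K} {u : K} (h : τ u = u⁻¹) (j : ℕ) :
    (τ ^ j) u = if Even j then u else u⁻¹ := by
  induction j with
  | zero => simp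
  | succ j ih =>
    rw [pow_succ', AlgEquiv.mul_apply, ih]
    by_cases hj : Even j <;> simp [hj, h, Nat.even_add_one]

lemma pow_apply_of_apply_eq_neg {τ : K ≃ₐ[F] K} {u : K} (h : τ u = -u) (j : ℕ) :
    (τ ^ j) u = (-1) ^ j * u := by
  induction j with
  | zero => simp
  | succ j ih =>
    rw [pow_succ', AlgEquiv.mul_apply, ih]
    simp [h, pow_succ]

/-- The alternating sum of the τ^i(x) over one period is negated by τ, and by Dedekind's
independence of characters it is nonzero for some x. -/
lemma exists_apply_eq_neg {τ : K ≃ₐ[F] K} (hτ : Even (orderOf τ)) (hpos : 0 < orderOf τ) :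
    ∃ a : K, a ≠ 0 ∧ τ a = -a := by
  set n := orderOf τ with hn
  have hx : ∃ x : K, ∑ i ∈ Finset.range n, (-1) ^ i * (τ ^ i) x ≠ 0 := by
    by_contra! hx
    have inj : Function.Injective (fun i : Fin n ↦ ((τ ^ (i : ℕ) : K ≃ₐ[F] K) : K →* K)) := by
      intro i j hij
      have : τ ^ (i : ℕ) = τ ^ (j : ℕ) := by
        ext x; exact DFunLike.congr_fun hij x
      exact Fin.ext (pow_injOn_Iio_orderOf (hn ▸ i.2) (hn ▸ j.2) this)
    have li := (linearIndependent_monoidHom K K).comp _ inj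
    rw [Fintype.linearIndependent_iff] at li
    have := li (fun i ↦ (-1) ^ (i : ℕ)) (by
      ext x
      have := hx x
      rw [Finset.sum_range] at this
      simpa using this) ⟨0, hpos⟩
    simp at this
  obtain ⟨x, hx⟩ := hx
  refine ⟨_, hx, ?_⟩
  -- The sum over 0, …, n is split at either end; both end terms equal x because n is even and τ^n =
  -- 1.
  have e := Finset.sum_range_succ (fun i ↦ (-1) ^ i * (τ ^ i) x) n
  rw [Finset.sum_range_succ'] at e
  simp only [pow_zero, AlgEquiv.one_apply, one_mul, hτ.neg_one_pow, hn ▸ pow_orderOf_eq_one τ,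
    add_left_inj] at e
  calc τ (∑ i ∈ Finset.range n, (-1) ^ i * (τ ^ i) x)
      = -∑ i ∈ Finset.range n, (-1) ^ (i + 1) * (τ ^ (i + 1)) x := by
        rw [map_sum, ← Finset.sum_neg_distrib]
        refine Finset.sum_congr rfl fun i _ ↦ ?_
        rw [map_mul, pow_succ' τ, AlgEquiv.mul_apply]
        simp [pow_succ]
    _ = _ := by rw [e]

lemma exists_odd_forall_apply_eq_pow [Finite F] [Finite K] (hF : Odd (Nat.card F))
    (τ : K ≃ₐ[F] K) : ∃ N, Odd N ∧ ∀ x, τ x = x ^ N := by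
  have := Fintype.ofFinite F
  obtain ⟨n, rfl⟩ := (FiniteField.bijective_frobeniusAlgEquivOfAlgebraic_pow F K).2 τ
  refine ⟨Fintype.card F ^ n.1, ?_, fun x ↦ ?_⟩
  · rw [← Nat.card_eq_fintype_card]; exact hF.pow
  · rw [AlgEquiv.coe_pow, FiniteField.coe_frobeniusAlgEquivOfAlgebraic_iterate]

lemma ringEquiv_apply_algEquiv_apply [Finite F] [Finite K] (ρ : K ≃+* K) (τ : K ≃ₐ[F] K) (x : K) :
    ρ (τ x) = τ (ρ x) := by
  have := Fintype.ofFinite F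
  obtain ⟨n, rfl⟩ := (FiniteField.bijective_frobeniusAlgEquivOfAlgebraic_pow F K).2 τ
  simp only [AlgEquiv.coe_pow, FiniteField.coe_frobeniusAlgEquivOfAlgebraic_iterate, map_pow]

/-! ### Generators of the Galois group and the relation ∼ -/

lemma exists_odd_eq_pow {G : Type*} [Group G] {t : ℕ} (ht : 0 < t) {σ τ : G}
    (hσ : orderOf σ = 2 * t) (hτ : orderOf τ = 2 * t) (h : τ ∈ Subgroup.zpowers σ) :
    ∃ i, Odd i ∧ τ = σ ^ i := by
  have hfin : IsOfFinOrder σ := orderOf_pos_iff.mp (by omega)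
  obtain ⟨i, hi⟩ := hfin.mem_powers_iff_mem_zpowers.mpr h
  refine ⟨i, ?_, hi.symm⟩
  by_contra hodd
  obtain ⟨j, rfl⟩ := Nat.not_odd_iff_even.mp hodd
  have : τ ^ t = 1 := by
    rw [← hi]
    simp only [← pow_mul]
    rw [show (j + j) * t = (2 * t) * j by ring, pow_mul, ← hσ, pow_orderOf_eq_one, one_pow]
  have := Nat.le_of_dvd ht (orderOf_dvd_of_pow_eq_one this)
  omega

lemma sq_apply_mul_of_odd {τ υ : K ≃ₐ[F] K} {i : ℕ} (hi : Odd i) (h : τ = υ ^ i) {l : K}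
    (hl : (υ ^ 2) l * l = 1) : (τ ^ 2) l * l = 1 := by
  have h0 : l ≠ 0 := right_ne_zero_of_mul_eq_one hl
  have := pow_apply_of_apply_eq_inv (eq_inv_of_mul_eq_one_left hl) i
  rw [h, ← pow_mul, mul_comm i, pow_mul, this, if_neg (Nat.not_even_iff_odd.mpr hi),
    inv_mul_cancel₀ h0]

/-- The left side says that the square of the Frobenius φ inverts l. Both σ and φ have order 2t, so
each is an odd power of the other, and odd powers of an inverting map still invert. -/
lemma pow_eq_one_iff_sq_apply_mul [Finite F] [Finite K] {σ : K ≃ₐ[F] K} {t : ℕ} (ht : 0 < t)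
    (hσ : orderOf σ = 2 * t) (hgen : ∀ τ : K ≃ₐ[F] K, τ ∈ Subgroup.zpowers σ)
    (hdim : Module.finrank F K = 2 * t) (l : K) :
    l ^ (Nat.card F ^ 2 + 1) = 1 ↔ (σ ^ 2) l * l = 1 := by
  have := Fintype.ofFinite F
  set φ := FiniteField.frobeniusAlgEquivOfAlgebraic F K
  have hφ : orderOf φ = 2 * t := by
    rw [FiniteField.orderOf_frobeniusAlgEquivOfAlgebraic, hdim]
  have e : l ^ (Nat.card F ^ 2 + 1) = (φ ^ 2) l * l := by
    rw [AlgEquiv.coe_pow, FiniteField.coe_frobeniusAlgEquivOfAlgebraic_iterate, pow_succ,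
      Nat.card_eq_fintype_card]
  rw [e]
  obtain ⟨i, hi, hi'⟩ := exists_odd_eq_pow ht hσ hφ (hgen φ)
  have hmem : σ ∈ Subgroup.zpowers φ := by
    obtain ⟨n, hn⟩ := (FiniteField.bijective_frobeniusAlgEquivOfAlgebraic_pow F K).2 σ
    exact ⟨n.1, by simpa using hn⟩
  obtain ⟨j, hj, hj'⟩ := exists_odd_eq_pow ht hφ hσ hmem
  exact ⟨sq_apply_mul_of_odd hj hj', sq_apply_mul_of_odd hi hi'⟩

lemma two_ne_zero_of_odd_card [Finite F] (hF : Odd (Nat.card F)) : (2 : K) ≠ 0 := by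
  have := Fintype.ofFinite F
  intro h
  obtain ⟨r, hr⟩ := hF
  have e : ((Nat.card F : F)) = 0 := by rw [Nat.card_eq_fintype_card, Nat.cast_card_eq_zero]
  have e' := congrArg (algebraMap F K) e
  rw [hr] at e'
  rw [map_natCast] at e'
  push_cast at e'
  rw [h] at e'
  simp at e'

section

variable {σ : K ≃ₐ[F] K} {t : ℕ}

/-- If 4 ∣ t, then σ^t is an even power of σ² and fixes l, while `h1` says that it inverts l. If t
is odd, the odd power (σ²)^t = 1 inverts l. Either way l² = 1. -/
lemma eq_one_or_neg_one_of_sq_apply (hσ : orderOf σ = 2 * t) (ht : ¬ t ≡ 2 [MOD 4]) {l : K}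
    (h2 : (σ ^ 2) l * l = 1) (h1 : (σ ^ t) l * l = 1) : l = 1 ∨ l = -1 := by
  have h0 : l ≠ 0 := right_ne_zero_of_mul_eq_one h2
  have key (j : ℕ) := pow_apply_of_apply_eq_inv (eq_inv_of_mul_eq_one_left h2) j
  rw [← sq_eq_one_iff]
  rcases Nat.even_or_odd t with he | ho
  · obtain ⟨m, rfl⟩ := he
    have hm : Even m := by
      by_contra hm
      obtain ⟨r, rfl⟩ := Nat.not_even_iff_odd.mp hm
      exact ht (by unfold Nat.ModEq; omega)
    have := key m
    rw [← pow_mul, if_pos hm, two_mul] at this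
    rw [this] at h1
    rw [sq, h1]
  · have := key t
    rw [← pow_mul, ← hσ, pow_orderOf_eq_one, if_neg (Nat.not_even_iff_odd.mpr ho),
      AlgEquiv.one_apply] at this
    rw [sq]; nth_rw 1 [this]; exact inv_mul_cancel₀ h0

lemma eqUpToFactor_iff [Finite F] [Finite K] (ht : 0 < t)
    (hσ : orderOf σ = 2 * t) (hgen : ∀ τ : K ≃ₐ[F] K, τ ∈ Subgroup.zpowers σ)
    (hdim : Module.finrank F K = 2 * t) {a b : K} (ha : (σ ^ t) a * a = -1)
    (hb : (σ ^ t) b * b = -1) :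
    EqUpToFactor (Nat.card F) t a b ↔ (σ ^ 2) (a / b) * (a / b) = 1 := by
  have hb0 : b ≠ 0 := by rintro rfl; simp at hb
  have h1 : (σ ^ t) (a / b) * (a / b) = 1 := by
    rw [map_div₀, div_mul_div_comm, ha, hb, div_self (by simp)]
  constructor
  · rintro ⟨H1, H2⟩
    by_cases hmod : t ≡ 2 [MOD 4]
    · obtain ⟨l, hl, rfl⟩ := H2 hmod
      rw [mul_div_cancel_right₀ _ hb0, ← pow_eq_one_iff_sq_apply_mul ht hσ hgen hdim, hl]
    · rcases H1 hmod with rfl | rfl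
      · simp [hb0]
      · simp [hb0]
  · intro H
    refine ⟨fun hmod ↦ ?_, fun hmod ↦ ⟨a / b, ?_, by field_simp⟩⟩
    · rcases eq_one_or_neg_one_of_sq_apply hσ hmod H h1 with e | e
      · left; rw [div_eq_iff hb0] at e; simpa using e
      · right; rw [div_eq_iff hb0] at e; simpa using e
    · rw [pow_eq_one_iff_sq_apply_mul ht hσ hgen hdim, H]

/-! ### Equivalences between signed codes -/

/-- A scalar on which the four exponents act alike up to the factors η, κ and ηκ multiplies ε by η
and δ by κ. -/
lemma rightEquiv_signedPsi_of_scalar {a η κ : K} (ha : a ≠ 0)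
    (h₁ : (σ ^ ((t : ℤ) - 1)) a = η * (σ ^ (1 : ℤ)) a)
    (h₂ : (σ ^ (-1 : ℤ)) a = κ * (σ ^ (1 : ℤ)) a)
    (h₃ : (σ ^ ((t : ℤ) + 1)) a = η * κ * (σ ^ (1 : ℤ)) a) (ε δ m : K) :
    RightEquiv (spanCode (signedPsi σ t (η * ε) (κ * δ) m)) (spanCode (signedPsi σ t ε δ m)) := by
  refine rightEquiv_spanCode_of_scalar (a := a) (d := (σ ^ (1 : ℤ)) a) ha (by simpa using ha) ?_
  rw [signedPsi, signedPsi, quad_mul_monomial, monomial_mul_quad, h₁, h₂, h₃]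
  congr 1 <;> ring

lemma rightEquiv_neg_left_of_odd (hσ : orderOf σ = 2 * t) (ht : Odd t) (ε δ m : K) :
    RightEquiv (spanCode (signedPsi σ t (-ε) δ m)) (spanCode (signedPsi σ t ε δ m)) := by
  obtain ⟨a, ha, hneg⟩ := exists_apply_eq_neg (τ := σ) (by simp [hσ])
    (by rw [hσ]; have := ht.pos; omega)
  have h1 : (σ ^ (1 : ℤ)) a = -a := by rwa [zpow_one]
  have hm : (σ ^ (-1 : ℤ)) a = -a := by
    have := congrArg (σ ^ (-1 : ℤ)) h1
    rw [zpow_apply_zpow_apply, map_neg] at this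
    simpa [eq_neg_iff_add_eq_zero, add_comm] using this
  have hT : (σ ^ (t : ℤ)) a = -a := by
    rw [zpow_natCast, pow_apply_of_apply_eq_neg hneg, ht.neg_one_pow, neg_one_mul]
  have := rightEquiv_signedPsi_of_scalar (σ := σ) (t := t) (a := a) (η := -1) (κ := 1) ha
    (by rw [sub_eq_add_neg, add_comm, ← zpow_apply_zpow_apply, hT, map_neg, hm, h1]; ring)
    (by rw [hm, h1]; ring)
    (by rw [add_comm, ← zpow_apply_zpow_apply, hT, map_neg, h1]; ring) ε δ m
  simpa using this

lemma rightEquiv_sign_neg_of_even (hσ : orderOf σ = 2 * t) {r : ℕ} (hr : t = 2 * r) (ht : 0 < t)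
    (ε δ m : K) :
    RightEquiv (spanCode (signedPsi σ t ((-1) ^ (r + 1) * ε) (-δ) m))
      (spanCode (signedPsi σ t ε δ m)) := by
  have hord : orderOf (σ ^ 2) = t := by
    rw [orderOf_pow' _ (by simp), hσ, Nat.gcd_eq_right (by simp)]; simp
  -- Since t is even, σ² has even order t. From σ²(a) = -a follows σ^t(a) = (-1)^r a, which is where
  -- the exponent r + 1 comes from.
  obtain ⟨a, ha, hneg⟩ := exists_apply_eq_neg (τ := σ ^ 2) (by rw [hord, hr]; simp) (by omega)
  have hm : (σ ^ (-1 : ℤ)) a = -(σ ^ (1 : ℤ)) a := by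
    have := congrArg (σ ^ (-1 : ℤ)) hneg
    rw [← zpow_natCast, zpow_apply_zpow_apply, map_neg] at this
    rw [← neg_eq_iff_eq_neg, ← this]; rfl
  have hT : (σ ^ (t : ℤ)) a = (-1) ^ r * a := by
    rw [zpow_natCast, hr, pow_mul, pow_apply_of_apply_eq_neg hneg]
  have := rightEquiv_signedPsi_of_scalar (σ := σ) (t := t) (a := a) (η := (-1) ^ (r + 1))
    (κ := -1) ha
    (by rw [sub_eq_add_neg, add_comm, ← zpow_apply_zpow_apply, hT, map_mul, hm]; simp [pow_succ])
    (by rw [hm]; ring)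
    (by rw [add_comm, ← zpow_apply_zpow_apply, hT, map_mul]; simp [pow_succ]) ε δ m
  simpa using this

/-- Otherwise σ² inverts h. If t/2 is odd, so does σ^t, against `hh`. If t/2 is even, σ^t fixes h,
so h² = -1, σ²(h) = h and σ²(h) h = -1 ≠ 1. -/
lemma mul_ne_one_of_even (h2 : (2 : K) ≠ 0) {h : K} (hh : (σ ^ t) h * h = -1) (ht : Even t) :
    (σ ^ (1 : ℤ)) h * (σ ^ (-1 : ℤ)) h ≠ 1 := by
  have h0 : h ≠ 0 := by rintro rfl; simp at hh
  intro H
  have H' : (σ ^ 2) h * h = 1 := by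
    have := congrArg (σ ^ (1 : ℤ)) H
    rw [map_mul, zpow_apply_zpow_apply, zpow_apply_zpow_apply, map_one] at this
    exact this
  have e := eq_inv_of_mul_eq_one_left H'
  obtain ⟨r, rfl⟩ := ht
  have e' := pow_apply_of_apply_eq_inv e r
  rw [← pow_mul, two_mul] at e'
  rw [e'] at hh
  split_ifs at hh with hr
  · have hsq : (σ ^ 1) h ^ 2 = h ^ 2 := by
      rw [← map_pow, sq h, hh, map_neg, map_one]
    have h4 : (σ ^ 2) h = h := by
      rw [pow_succ', AlgEquiv.mul_apply]
      rcases sq_eq_sq_iff_eq_or_eq_neg.mp hsq with e | e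
      · rw [e]; simpa using e
      · rw [e, map_neg, ← pow_one σ, e, neg_neg]
    rw [h4, hh] at H'
    exact h2 (by linear_combination -H')
  · rw [inv_mul_cancel₀ h0] at hh
    exact h2 (by linear_combination hh)

lemma neg_inv_div_one_sub_inv {x y : K} (hx : x ≠ 0) (hy : y ≠ 0) :
    -y⁻¹ / (1 - (x * y)⁻¹) = x / (1 - x * y) := by
  by_cases h : 1 - x * y = 0
  · have : x * y = 1 := by linear_combination -h
    simp [this]
  · have : 1 - (x * y)⁻¹ = -(1 - x * y) / (x * y) := by field_simp; ring
    rw [this]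
    field_simp

lemma rightEquiv_neg_one_one_of_even [Finite K] [FiniteDimensional F K] (hσ : orderOf σ = 2 * t)
    (h2 : (2 : K) ≠ 0) {h : K} (hh : (σ ^ t) h * h = -1) (ht : Even t) :
    RightEquiv (spanCode (signedPsi σ t (-1) 1 h)) (spanCode (signedPsi σ t 1 1 h)) := by
  have h0 : h ≠ 0 := by rintro rfl; simp at hh
  have hv := mul_ne_one_of_even h2 hh ht
  have hT := zpow_t_add_apply hh
  have nz (i : ℤ) : (σ ^ i) h ≠ 0 := by simpa using h0
  have hv' : 1 - (σ ^ (1 : ℤ)) h * (σ ^ (-1 : ℤ)) h ≠ 0 := sub_ne_zero.mpr hv.symm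
  -- This b satisfies σ^t(b) σ⁻¹(h) = b σ(h), as the vanishing of the coefficient at σ² requires.
  -- With it, ψ^{1,1} ∘ bψ^{-1,1} is a scalar.
  set b := (σ ^ (-1 : ℤ)) h / (1 - (σ ^ (1 : ℤ)) h * (σ ^ (-1 : ℤ)) h) with hb
  have hP : 1 - (σ ^ (2 : ℤ)) h * h ≠ 0 := by
    have : (σ ^ (1 : ℤ)) (1 - (σ ^ (1 : ℤ)) h * (σ ^ (-1 : ℤ)) h) ≠ 0 :=
      (map_ne_zero _).mpr hv'
    rw [map_sub, map_one, map_mul, zpow_apply_zpow_apply, zpow_apply_zpow_apply] at this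
    exact this
  have hQ : 1 - h * (σ ^ (-2 : ℤ)) h ≠ 0 := by
    have : (σ ^ (-1 : ℤ)) (1 - (σ ^ (1 : ℤ)) h * (σ ^ (-1 : ℤ)) h) ≠ 0 :=
      (map_ne_zero _).mpr hv'
    rw [map_sub, map_one, map_mul, zpow_apply_zpow_apply, zpow_apply_zpow_apply] at this
    exact this
  have b1 : (σ ^ (1 : ℤ)) b = h / (1 - (σ ^ (2 : ℤ)) h * h) := by
    rw [hb, map_div₀, map_sub, map_one, map_mul, zpow_apply_zpow_apply, zpow_apply_zpow_apply]
    rfl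
  have bm : (σ ^ (-1 : ℤ)) b = (σ ^ (-2 : ℤ)) h / (1 - h * (σ ^ (-2 : ℤ)) h) := by
    rw [hb, map_div₀, map_sub, map_one, map_mul, zpow_apply_zpow_apply, zpow_apply_zpow_apply]
    rfl
  have a1 : (σ ^ (1 : ℤ)) ((σ ^ (1 : ℤ)) h) = (σ ^ (2 : ℤ)) h := zpow_apply_zpow_apply ..
  have a2 : (σ ^ (1 : ℤ)) ((σ ^ (-1 : ℤ)) h) = h := zpow_apply_zpow_apply ..
  have a3 : (σ ^ (-1 : ℤ)) ((σ ^ (1 : ℤ)) h) = h := zpow_apply_zpow_apply ..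
  have a4 : (σ ^ (-1 : ℤ)) ((σ ^ (-1 : ℤ)) h) = (σ ^ (-2 : ℤ)) h := zpow_apply_zpow_apply ..
  have a5 : (σ ^ ((t : ℤ) + 1)) h = -((σ ^ (1 : ℤ)) h)⁻¹ := hT 1
  have a6 : (σ ^ ((t : ℤ) + 1)) ((σ ^ (1 : ℤ)) h) = -((σ ^ (2 : ℤ)) h)⁻¹ := by
    rw [zpow_apply_zpow_apply, add_assoc, hT]; rfl
  have a7 : (σ ^ ((t : ℤ) + 1)) ((σ ^ (-1 : ℤ)) h) = -h⁻¹ := by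
    rw [zpow_apply_zpow_apply, add_assoc, hT]; rfl
  have a8 : (σ ^ ((t : ℤ) - 1)) h = -((σ ^ (-1 : ℤ)) h)⁻¹ := by
    rw [sub_eq_add_neg, hT]
  have a9 : (σ ^ ((t : ℤ) - 1)) ((σ ^ (1 : ℤ)) h) = -h⁻¹ := by
    rw [zpow_apply_zpow_apply, sub_eq_add_neg, add_assoc, hT]; rfl
  have a10 : (σ ^ ((t : ℤ) - 1)) ((σ ^ (-1 : ℤ)) h) = -((σ ^ (-2 : ℤ)) h)⁻¹ := by
    rw [zpow_apply_zpow_apply, sub_eq_add_neg, add_assoc, hT]; rfl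
  have bt1 : (σ ^ ((t : ℤ) + 1)) b = (σ ^ (2 : ℤ)) h / (1 - (σ ^ (2 : ℤ)) h * h) := by
    rw [hb, map_div₀, map_sub, map_one, map_mul, a6, a7, neg_mul_neg, ← mul_inv]
    exact neg_inv_div_one_sub_inv (nz 2) h0
  have btm : (σ ^ ((t : ℤ) - 1)) b = h / (1 - h * (σ ^ (-2 : ℤ)) h) := by
    rw [hb, map_div₀, map_sub, map_one, map_mul, a9, a10, neg_mul_neg, ← mul_inv]
    exact neg_inv_div_one_sub_inv h0 (nz (-2))
  refine rightEquiv_spanCode_of_inverse (b := b)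
    (c := (σ ^ (1 : ℤ)) h - ((σ ^ (-1 : ℤ)) h)⁻¹) (div_ne_zero (nz _) hv') ?_ ?_
  · intro e
    rw [sub_eq_zero] at e
    exact hv (by rw [e, inv_mul_cancel₀ (nz _)])
  · rw [signedPsi, signedPsi, monomial_mul_quad, quad_mul_quad hσ]
    have : monomial 1 ((σ ^ (1 : ℤ)) h - ((σ ^ (-1 : ℤ)) h)⁻¹) =
      hexa σ t ((σ ^ (1 : ℤ)) h - ((σ ^ (-1 : ℤ)) h)⁻¹) 0 0 0 0 0 := by simp [hexa, monomial_zero]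
    rw [this]
    simp only [map_mul, map_one, one_mul, mul_one, map_div₀, map_neg, b1, bm, bt1, btm,
      a1, a2, a3, a4, a5, a6, a7, a8, a9, a10]
    have n1 := nz 1
    have n2 := nz 2
    have nm := nz (-1)
    have nm2 := nz (-2)
    generalize (σ ^ (1 : ℤ)) h = x1 at *
    generalize (σ ^ (2 : ℤ)) h = x2 at *
    generalize (σ ^ (-1 : ℤ)) h = y1 at *
    generalize (σ ^ (-2 : ℤ)) h = y2 at *
    have hP' : 1 - h * x2 ≠ 0 := by rwa [mul_comm]
    congr 1
    all_goals
      field_simp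
      ring

/-- A factor `l` with `σ²(l) l = 1` does not change the code. -/
lemma rightEquiv_mul [Finite F] [Finite K] (hF : Odd (Nat.card F)) (hσ : orderOf σ = 2 * t)
    {m l : K} (h2 : (σ ^ 2) l * l = 1) (h1 : (σ ^ t) l * l = 1) :
    RightEquiv (spanCode (signedPsi σ t 1 1 (l * m))) (spanCode (signedPsi σ t 1 1 m)) := by
  have h0 : l ≠ 0 := right_ne_zero_of_mul_eq_one h2
  by_cases hmod : t ≡ 2 [MOD 4]
  swap
  · have : signedPsi σ t 1 1 (l * m) = signedPsi σ t 1 1 m := by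
      rcases eq_one_or_neg_one_of_sq_apply hσ hmod h2 h1 with rfl | rfl <;> simp [signedPsi]
    rw [this]
    exact RightEquiv.refl _
  obtain ⟨N, ⟨r, hr⟩, hN⟩ := exists_odd_forall_apply_eq_pow hF (σ ^ (-1 : ℤ))
  have e2 := eq_inv_of_mul_eq_one_left h2
  -- The scalar must satisfy a² = (l σ⁻¹(l))⁻¹. As σ⁻¹ is x ↦ x^(2r+1), the product l σ⁻¹(l) is
  -- l^(2r+2), with the explicit square root l^(r+1).
  set a := (l ^ (r + 1))⁻¹ with ha
  have ha0 : a ≠ 0 := by simp [ha, h0]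
  have hsq : a ^ 2 * (l * (σ ^ (-1 : ℤ)) l) = 1 := by
    rw [hN, hr, ha]; field_simp; ring
  have a2 : (σ ^ 2) a = a⁻¹ := by rw [ha, map_inv₀, map_pow, e2, inv_pow]
  clear_value a
  have aT : (σ ^ (t : ℤ)) a = a⁻¹ := by
    obtain ⟨s, hs, rfl⟩ : ∃ s, ¬ Even s ∧ t = 2 * s := by
      refine ⟨t / 2, ?_, ?_⟩ <;> unfold Nat.ModEq at hmod
      · rw [Nat.even_iff]; omega
      · omega
    rw [zpow_natCast, pow_mul, pow_apply_of_apply_eq_inv a2, if_neg hs]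
  have am : (σ ^ (-1 : ℤ)) a = ((σ ^ (1 : ℤ)) a)⁻¹ := by
    have := congrArg (σ ^ (-1 : ℤ)) a2
    rw [← zpow_natCast, zpow_apply_zpow_apply, map_inv₀] at this
    rw [← inv_inv ((σ ^ (-1 : ℤ)) a), ← this]; rfl
  have lm : (σ ^ (-1 : ℤ)) l = ((σ ^ (1 : ℤ)) l)⁻¹ := by
    have := congrArg (σ ^ (-1 : ℤ)) e2
    rw [← zpow_natCast, zpow_apply_zpow_apply, map_inv₀] at this
    rw [← inv_inv ((σ ^ (-1 : ℤ)) l), ← this]; rfl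
  have hsq1 : (σ ^ (1 : ℤ)) a ^ 2 * ((σ ^ (1 : ℤ)) l * l) = 1 := by
    have := congrArg (σ ^ (1 : ℤ)) hsq
    rw [map_mul, map_mul, map_pow, zpow_apply_zpow_apply, map_one] at this
    exact this
  have n1 : (σ ^ (1 : ℤ)) a ≠ 0 := (map_ne_zero _).mpr ha0
  have l1 : (σ ^ (1 : ℤ)) l ≠ 0 := (map_ne_zero _).mpr h0
  refine rightEquiv_spanCode_of_scalar (a := a) (d := (σ ^ (1 : ℤ)) a) ha0 n1 ?_
  rw [signedPsi, signedPsi, quad_mul_monomial, monomial_mul_quad, am, sub_eq_add_neg,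
    add_comm (t : ℤ), add_comm (t : ℤ), ← zpow_apply_zpow_apply, ← zpow_apply_zpow_apply, aT,
    map_inv₀, map_inv₀, am, map_mul, map_mul, lm]
  by_cases hm0 : m = 0
  · subst hm0; simp
  have m1 : (σ ^ (-1 : ℤ)) m ≠ 0 := (map_ne_zero _).mpr hm0
  congr 1
  · ring
  · simp
  · field_simp
    linear_combination (-(σ ^ (1 : ℤ)) m) * hsq1
  · field_simp
    linear_combination -hsq1

end

/-! ### Twisting codes -/

lemma twist_image_code [Finite F] [Finite K] (ρ : K ≃+* K) (k : K) (t : ℕ) (θ : K ≃ₐ[F] K) :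
    twist ρ '' code k t θ = code (ρ k) t θ := by
  have key (c d : K) : twist ρ (monomial 1 c + monomial 1 d * psi k t θ) =
      monomial 1 (ρ c) + monomial 1 (ρ d) * psi (ρ k) t θ := by
    simp only [psi, mul_add, monomial_mul_monomial, twist_add, twist_monomial, map_mul, map_one,
      map_inv₀, ringEquiv_apply_algEquiv_apply, AlgEquiv.one_apply]
  ext f
  simp only [code_eq_spanCode, spanCode, Set.mem_image, Set.mem_ofPred_eq]
  constructor
  · rintro ⟨_, ⟨c, d, rfl⟩, rfl⟩
    exact ⟨_, _, key c d⟩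
  · rintro ⟨c, d, rfl⟩
    exact ⟨_, ⟨ρ.symm c, ρ.symm d, rfl⟩, by simp [key]⟩

lemma monomial_mul_twist {τ : K ≃ₐ[F] K} (hcomm : ∀ υ : K ≃ₐ[F] K, τ * υ = υ * τ) (c : K)
    (ρ : K ≃+* K) (g : SigmaPoly F K) :
    monomial τ c * twist ρ g =
      monomial 1 c * twist (ρ.trans (τ : K ≃+* K)) g * monomial τ 1 := by
  induction g using SkewMonoidAlgebra.induction_on with
  | zero => simp [twist]
  | single υ a =>
    change monomial τ c * twist ρ (monomial υ a) =
      monomial 1 c * twist (ρ.trans (τ : K ≃+* K)) (monomial υ a) * monomial τ 1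
    simp only [twist_monomial, monomial_mul_monomial, one_mul, hcomm, map_one, mul_one]
    rfl
  | add f g hf hg => simp only [twist_add, mul_add, add_mul, hf, hg]

/-- Comparing coefficients in f ∘ β = β' ∘ f, every exponent τ in the support has τ(β) = β', so any
two of them coincide. -/
lemma eq_monomial_of_normalizes {f : SigmaPoly F K} (hf : f ≠ 0)
    (h : ∀ β : K, ∃ β', f * monomial 1 β = monomial 1 β' * f) :
    ∃ τ c, c ≠ 0 ∧ f = monomial τ c := by
  have key (β : K) : ∃ β', ∀ τ, f.coeff τ ≠ 0 → τ β = β' := by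
    obtain ⟨β', hβ⟩ := h β
    refine ⟨β', fun τ hτ ↦ ?_⟩
    have := congrArg (fun g ↦ g.coeff τ) hβ
    simp only [coeff_mul_monomial_one, coeff_monomial_one_mul, mul_comm β'] at this
    exact mul_left_cancel₀ hτ this
  obtain ⟨τ, hτ⟩ : ∃ τ, f.coeff τ ≠ 0 := by
    by_contra! H
    exact hf (SkewMonoidAlgebra.ext fun τ ↦ by simpa using H τ)
  refine ⟨τ, f.coeff τ, hτ, ?_⟩
  ext υ
  by_cases hυ : τ = υ
  · rw [hυ, coeff_monomial_self]
  · rw [coeff_monomial_of_ne hυ]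
    by_contra H
    refine hυ (AlgEquiv.ext fun β ↦ ?_)
    obtain ⟨β', hβ⟩ := key β
    rw [hβ τ hτ, hβ υ H]

lemma monomial_one_mul_mem_spanCode {P f : SigmaPoly F K} (c : K) (hf : f ∈ spanCode P) :
    monomial 1 c * f ∈ spanCode P := by
  obtain ⟨x, y, rfl⟩ := hf
  exact ⟨c * x, c * y, by simp [mul_add, ← mul_assoc, monomial_mul_monomial]⟩

section

variable {σ : K ≃ₐ[F] K} {t : ℕ}

lemma psi_eq_signedPsi (hσ : orderOf σ = 2 * t) (k : K) : psi k t σ = signedPsi σ t 1 1 k := by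
  have : σ ^ (2 * (t : ℤ) - 1) = σ ^ (-1 : ℤ) := zpow_congr_of_order hσ 1 (by ring)
  simp [psi, signedPsi, quad, this, div_eq_mul_inv]

/-- An equivalence with `C_{h,t,σ}` is a twist of the coefficients followed by a right
translation. -/
lemma exists_rightEquiv_of_codeEquiv [Finite F] [Finite K] (hσ : orderOf σ = 2 * t) (ht : 5 ≤ t)
    (hgen : ∀ τ : K ≃ₐ[F] K, τ ∈ Subgroup.zpowers σ) (h2 : (2 : K) ≠ 0)
    {h k : K} (hh : (σ ^ t) h * h = -1) (θ : K ≃ₐ[F] K)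
    (H : CodeEquiv (code h t σ) (code k t θ)) :
    ∃ ρ : K ≃+* K, RightEquiv (code h t σ) (code (ρ k) t θ) := by
  obtain ⟨f₁, f₂, hf₁, hf₂, ρ, H⟩ := H
  have hcomm (τ υ : K ≃ₐ[F] K) : τ * υ = υ * τ := by
    obtain ⟨i, rfl⟩ := hgen τ
    obtain ⟨j, rfl⟩ := hgen υ
    simp only [← zpow_add, add_comm]
  obtain ⟨g₁, hg₁, hg₁'⟩ := isUnit_iff_exists.mp hf₁
  -- The scalars stabilise the twisted code on the left, so their conjugates by f₁ lie in the left
  -- idealiser of `code h t σ`.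
  have hstab (β : K) : ∀ f ∈ code h t σ,
      f₁ * monomial 1 β * g₁ * f ∈ code h t σ := by
    intro f hf
    rw [H] at hf ⊢
    obtain ⟨g, hg, rfl⟩ := hf
    have hg' : monomial 1 β * twist ρ g ∈ twist ρ '' code k t θ := by
      rw [twist_image_code, code_eq_spanCode]
      refine monomial_one_mul_mem_spanCode _ ?_
      rw [← code_eq_spanCode, ← twist_image_code]
      exact ⟨g, hg, rfl⟩
    obtain ⟨g', hg', e⟩ := hg'
    refine ⟨g', hg', ?_⟩
    rw [e]
    simp only [mul_assoc]
    rw [← mul_assoc g₁ f₁, hg₁', one_mul]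
  have hnorm (β : K) : ∃ β', f₁ * monomial 1 β = monomial 1 β' * f₁ := by
    have := hstab β
    rw [code_eq_spanCode, psi_eq_signedPsi hσ] at this
    obtain ⟨β', e⟩ := eq_monomial_of_mul_mem_spanCode hσ ht h2 hh this
    exact ⟨β', by rw [← e, mul_assoc, hg₁', mul_one]⟩
  obtain ⟨τ, c, hc, rfl⟩ := eq_monomial_of_normalizes hf₁.ne_zero hnorm
  refine ⟨ρ.trans (τ : K ≃+* K), monomial τ 1 * f₂, (isUnit_monomial τ one_ne_zero).mul hf₂, ?_⟩
  rw [H, ← twist_image_code]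
  ext f
  constructor
  · rintro ⟨g, hg, rfl⟩
    refine ⟨monomial 1 c * twist (ρ.trans (τ : K ≃+* K)) g, ?_, ?_⟩
    · rw [twist_image_code, code_eq_spanCode]
      refine monomial_one_mul_mem_spanCode _ ?_
      rw [← code_eq_spanCode, ← twist_image_code]
      exact ⟨g, hg, rfl⟩
    · simp only [monomial_mul_twist (hcomm τ), mul_assoc]
  · rintro ⟨g, hg, rfl⟩
    have hg' : monomial 1 c⁻¹ * g ∈ twist (ρ.trans (τ : K ≃+* K)) '' code k t θ := by
      rw [twist_image_code, code_eq_spanCode] at hg ⊢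
      exact monomial_one_mul_mem_spanCode _ hg
    obtain ⟨g', hg', e⟩ := hg'
    refine ⟨g', hg', ?_⟩
    rw [monomial_mul_twist (hcomm τ), e, ← mul_assoc (monomial 1 c), monomial_mul_monomial]
    simp [hc, monomial_one_one, mul_assoc]

/-! ### The codes `C_{k,t,θ}` as signed codes -/

lemma code_zpow_sub_one (hσ : orderOf σ = 2 * t) (ht : Even t) {k : K}
    (hk : (σ ^ t) k * k = -1) :
    code k t (σ ^ ((t : ℤ) - 1)) = spanCode (signedPsi σ t 1 (-1) k) := by
  obtain ⟨r, hr⟩ := ht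
  have hr' : (t : ℤ) = r + r := by exact_mod_cast hr
  have e1 : σ ^ (((t : ℤ) - 1) * (t - 1)) = σ ^ (1 : ℤ) :=
    zpow_congr_of_order hσ (r - 1) (by rw [hr']; ring)
  have e2 : σ ^ (((t : ℤ) - 1) * (t + 1)) = σ ^ (-1 : ℤ) :=
    zpow_congr_of_order hσ r (by rw [hr']; ring)
  have e3 : σ ^ (((t : ℤ) - 1) * (2 * t - 1)) = σ ^ ((t : ℤ) + 1) :=
    zpow_congr_of_order hσ (t - 2) (by ring)
  have e4 : (σ ^ ((t : ℤ) - 1)) k = -((σ ^ (-1 : ℤ)) k)⁻¹ := by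
    rw [sub_eq_add_neg, zpow_t_add_apply hk]
  have e5 : (σ ^ ((t : ℤ) - 1))⁻¹ k = -((σ ^ (1 : ℤ)) k)⁻¹ := by
    rw [← zpow_t_add_apply hk, ← zpow_neg]
    exact DFunLike.congr_fun (zpow_congr_of_order hσ (-1) (by ring)) k
  rw [code_eq_spanCode, psi, signedPsi, quad, ← zpow_mul, ← zpow_mul, ← zpow_mul, e1, e2, e3, e4,
    map_inv₀, e5]
  congr 1
  simp only [inv_neg, inv_inv, div_eq_mul_inv]
  ring_nf
  abel

lemma rightEquiv_code_inv (hσ : orderOf σ = 2 * t) {k : K} (hk : (σ ^ t) k * k = -1) :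
    RightEquiv (spanCode (signedPsi σ t (-1) 1 k⁻¹)) (code k t (σ ^ (-1 : ℤ))) := by
  have k0 : k ≠ 0 := by rintro rfl; simp at hk
  have e1 : σ ^ ((-1 : ℤ) * (t - 1)) = σ ^ ((t : ℤ) + 1) :=
    zpow_congr_of_order hσ (-1) (by ring)
  have e2 : σ ^ ((-1 : ℤ) * (t + 1)) = σ ^ ((t : ℤ) - 1) :=
    zpow_congr_of_order hσ (-1) (by ring)
  have e3 : σ ^ ((-1 : ℤ) * (2 * t - 1)) = σ ^ (1 : ℤ) :=
    zpow_congr_of_order hσ (-1) (by ring)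
  have e4 : (σ ^ (-1 : ℤ))⁻¹ = σ ^ (1 : ℤ) := by rw [← zpow_neg]; rfl
  have hP : psi k t (σ ^ (-1 : ℤ)) =
      quad σ t (k * ((σ ^ (1 : ℤ)) k)⁻¹) (k * (σ ^ (-1 : ℤ)) k) 1 1 := by
    rw [psi, quad, ← zpow_mul, ← zpow_mul, ← zpow_mul, e1, e2, e3, e4, map_inv₀]
    abel
  have n1 : (σ ^ (1 : ℤ)) k ≠ 0 := (map_ne_zero _).mpr k0
  have nm : (σ ^ (-1 : ℤ)) k ≠ 0 := (map_ne_zero _).mpr k0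
  rw [code_eq_spanCode]
  refine rightEquiv_spanCode_of_scalar (a := k) (d := k) k0 k0 ?_
  rw [hP, signedPsi, quad_mul_monomial, monomial_mul_quad, sub_eq_add_neg, zpow_t_add_apply hk,
    zpow_t_add_apply hk, map_inv₀, map_inv₀]
  congr 1 <;> field_simp

lemma rightEquiv_code_zpow_add_one (hσ : orderOf σ = 2 * t) (ht : Even t) {k : K}
    (hk : (σ ^ t) k * k = -1) :
    RightEquiv (spanCode (signedPsi σ t (-1) (-1) k⁻¹)) (code k t (σ ^ ((t : ℤ) + 1))) := by
  have k0 : k ≠ 0 := by rintro rfl; simp at hk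
  obtain ⟨r, hr⟩ := ht
  have hr' : (t : ℤ) = r + r := by exact_mod_cast hr
  have e1 : σ ^ (((t : ℤ) + 1) * (t - 1)) = σ ^ (-1 : ℤ) :=
    zpow_congr_of_order hσ r (by rw [hr']; ring)
  have e2 : σ ^ (((t : ℤ) + 1) * (t + 1)) = σ ^ (1 : ℤ) :=
    zpow_congr_of_order hσ (r + 1) (by rw [hr']; ring)
  have e3 : σ ^ (((t : ℤ) + 1) * (2 * t - 1)) = σ ^ ((t : ℤ) - 1) :=
    zpow_congr_of_order hσ t (by ring)
  have e5 : (σ ^ ((t : ℤ) + 1))⁻¹ k = -((σ ^ (-1 : ℤ)) k)⁻¹ := by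
    rw [← zpow_t_add_apply hk, ← zpow_neg]
    exact DFunLike.congr_fun (zpow_congr_of_order hσ (-1) (by ring)) k
  have hP : psi k t (σ ^ ((t : ℤ) + 1)) =
      quad σ t (-(k * ((σ ^ (1 : ℤ)) k)⁻¹)) (-(k * (σ ^ (-1 : ℤ)) k)) 1 1 := by
    rw [psi, quad, ← zpow_mul, ← zpow_mul, ← zpow_mul, e1, e2, e3, map_inv₀, e5,
      zpow_t_add_apply hk, inv_neg, inv_inv, mul_neg, mul_neg]
    abel
  have n1 : (σ ^ (1 : ℤ)) k ≠ 0 := (map_ne_zero _).mpr k0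
  have nm : (σ ^ (-1 : ℤ)) k ≠ 0 := (map_ne_zero _).mpr k0
  rw [code_eq_spanCode]
  refine rightEquiv_spanCode_of_scalar (a := k) (d := -k) k0 (neg_ne_zero.mpr k0) ?_
  rw [hP, signedPsi, quad_mul_monomial, monomial_mul_quad, sub_eq_add_neg, zpow_t_add_apply hk,
    zpow_t_add_apply hk, map_inv₀, map_inv₀]
  congr 1 <;> field_simp

/-- The equivalence problem for `C_{h,t,σ}` and `C_{k,t,θ}`, when the latter is a translate of a
signed code with parameter `ν k`. -/
lemma codeEquiv_iff [Finite F] [Finite K] (hF : Odd (Nat.card F))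
    (hσ : orderOf σ = 2 * t) (ht : 5 ≤ t)
    (hgen : ∀ τ : K ≃ₐ[F] K, τ ∈ Subgroup.zpowers σ) (hdim : Module.finrank F K = 2 * t)
    {h k : K} (hh : (σ ^ t) h * h = -1) (hk : (σ ^ t) k * k = -1)
    (θ : K ≃ₐ[F] K) (ε δ : K) (hε : ε = 1 ∨ ε = -1) (hδ : δ = 1 ∨ δ = -1) (ν : K → K)
    (hνρ : ∀ (ρ : K ≃+* K) x, ρ (ν x) = ν (ρ x))
    (hν : ∀ x, (σ ^ t) x * x = -1 → (σ ^ t) (ν x) * ν x = -1)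
    (hθ : ∀ x, (σ ^ t) x * x = -1 →
      RightEquiv (spanCode (signedPsi σ t ε δ (ν x))) (code x t θ))
    (hsign : ∀ x, (σ ^ t) x * x = -1 →
      RightEquiv (spanCode (signedPsi σ t ε δ x)) (spanCode (signedPsi σ t 1 1 x))) :
    CodeEquiv (code h t σ) (code k t θ) ↔
      ∃ ρ : K ≃+* K, EqUpToFactor (Nat.card F) t (ρ h) (ν k) := by
  have h2 : (2 : K) ≠ 0 := two_ne_zero_of_odd_card hF
  have hρ (ρ : K ≃+* K) {x : K} (hx : (σ ^ t) x * x = -1) : (σ ^ t) (ρ x) * ρ x = -1 := by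
    rw [← ringEquiv_apply_algEquiv_apply, ← map_mul, hx, map_neg, map_one]
  have hcode : code h t σ = spanCode (signedPsi σ t 1 1 h) := by
    rw [code_eq_spanCode, psi_eq_signedPsi hσ]
  have ne0 {x : K} (hx : (σ ^ t) x * x = -1) : x ≠ 0 := by rintro rfl; simp at hx
  constructor
  · intro H
    obtain ⟨ρ, H⟩ := exists_rightEquiv_of_codeEquiv hσ ht hgen h2 hh θ H
    have hm := hν _ (hρ ρ hk)
    have := mul_eq_mul_of_rightEquiv hσ ht hh (ne0 hm) hε hδ
      (hcode ▸ H.trans (hθ _ (hρ ρ hk)).symm)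
    -- The code equivalence twists k, whereas the criterion twists h; hence the inverse
    -- automorphism.
    refine ⟨ρ.symm, ?_⟩
    rw [eqUpToFactor_iff (by omega) hσ hgen hdim (hρ _ hh) (hν _ hk)]
    have e : ρ.symm h / ν k = ρ.symm (h / ν (ρ k)) := by
      rw [map_div₀, hνρ]; simp
    rw [e, ← ringEquiv_apply_algEquiv_apply, ← map_mul, map_div₀, div_mul_div_comm]
    have e' := congrArg (σ ^ (1 : ℤ)) this
    rw [map_mul, map_mul, zpow_apply_zpow_apply, zpow_apply_zpow_apply, zpow_apply_zpow_apply,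
      zpow_apply_zpow_apply] at e'
    have e'' : (σ ^ 2) h * h = (σ ^ 2) (ν (ρ k)) * ν (ρ k) := e'
    rw [e'', div_self (mul_ne_zero ((map_ne_zero _).mpr (ne0 hm)) (ne0 hm)), map_one]
  · rintro ⟨ρ, H⟩
    rw [eqUpToFactor_iff (by omega) hσ hgen hdim (hρ _ hh) (hν _ hk)] at H
    apply RightEquiv.codeEquiv (ρ := ρ.symm)
    rw [twist_image_code, hcode]
    have hk' := hρ ρ.symm hk
    have hm := hν _ hk'
    refine RightEquiv.trans ?_ ((hsign _ hm).symm.trans (hθ _ hk'))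
    have H' := congrArg ρ.symm H
    have e : ρ.symm (ρ h / ν k) = h / ν (ρ.symm k) := by
      rw [map_div₀, hνρ]; simp
    rw [map_mul, ringEquiv_apply_algEquiv_apply, e, map_one] at H'
    have := rightEquiv_mul hF hσ (m := ν (ρ.symm k)) H' (by
      rw [map_div₀, div_mul_div_comm, hh, hm, div_self (by simp)])
    rwa [div_mul_cancel₀ _ (ne0 hm)] at this

/-- A scalar flips δ alone when t/2 is odd, and both signs when t/2 is even. Combined with the flip
of ε at δ = 1, this reaches all four sign pairs. -/
lemma rightEquiv_signed_neg_one_of_even [Finite K] [FiniteDimensional F K] (hσ : orderOf σ = 2 * t)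
    (ht0 : 0 < t) (h2 : (2 : K) ≠ 0) {h : K} (hh : (σ ^ t) h * h = -1) (ht : Even t) :
    RightEquiv (spanCode (signedPsi σ t 1 (-1) h)) (spanCode (signedPsi σ t 1 1 h)) ∧
    RightEquiv (spanCode (signedPsi σ t (-1) (-1) h)) (spanCode (signedPsi σ t 1 1 h)) := by
  have hneg := rightEquiv_neg_one_one_of_even hσ h2 hh ht
  obtain ⟨r, hr⟩ := ht
  rw [← two_mul] at hr
  have flip (ε : K) := rightEquiv_sign_neg_of_even hσ hr ht0 ε 1 h
  rcases Nat.even_or_odd r with he | ho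
  · have e : (-1 : K) ^ (r + 1) = -1 := he.add_one.neg_one_pow
    have f1 := flip 1
    have f2 := flip (-1)
    simp only [e, mul_one, neg_mul_neg] at f1 f2
    exact ⟨f2.trans hneg, f1⟩
  · have e : (-1 : K) ^ (r + 1) = 1 := ho.add_one.neg_one_pow
    have f1 := flip 1
    have f2 := flip (-1)
    simp only [e, one_mul] at f1 f2
    exact ⟨f1, f2.trans hneg⟩

end

end RankMetric

end

/-! ### The four choices of generator -/

theorem theorem4p6 {F K : Type*} [Field F] [Finite F] [Field K] [Algebra F K]
    (q : ℕ) (hq : Nat.card F = q) (hodd : Odd q)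
    (t : ℕ) (ht : 5 ≤ t) (hdim : Module.finrank F K = 2 * t)
    (σ : K ≃ₐ[F] K) (hσ : ∀ τ : K ≃ₐ[F] K, τ ∈ Subgroup.zpowers σ)
    (h k : K) (hh : (σ ^ t) h * h = -1) (hk : (σ ^ t) k * k = -1) :
    (RankMetric.CodeEquiv (RankMetric.code h t σ) (RankMetric.code k t (σ ^ (1 : ℤ))) ↔
      ∃ ρ : K ≃+* K, RankMetric.EqUpToFactor q t (ρ h) k) ∧
    (RankMetric.CodeEquiv (RankMetric.code h t σ) (RankMetric.code k t (σ ^ (-1 : ℤ))) ↔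
      ∃ ρ : K ≃+* K, RankMetric.EqUpToFactor q t (ρ h) k⁻¹) ∧
    (Even t →
      (RankMetric.CodeEquiv (RankMetric.code h t σ) (RankMetric.code k t (σ ^ ((t : ℤ) - 1))) ↔
        ∃ ρ : K ≃+* K, RankMetric.EqUpToFactor q t (ρ h) k)) ∧
    (Even t →
      (RankMetric.CodeEquiv (RankMetric.code h t σ) (RankMetric.code k t (σ ^ ((t : ℤ) + 1))) ↔
        ∃ ρ : K ≃+* K, RankMetric.EqUpToFactor q t (ρ h) k⁻¹)) := by
  subst hq
  have : FiniteDimensional F K := Module.finite_of_finrank_pos (by omega)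
  have : Finite K := Module.finite_of_finite F
  have hord : orderOf σ = 2 * t := by
    rw [orderOf_eq_card_of_forall_mem_zpowers hσ, IsGalois.card_aut_eq_finrank, hdim]
  have h2 : (2 : K) ≠ 0 := RankMetric.two_ne_zero_of_odd_card hodd
  have hinv (x : K) (hx : (σ ^ t) x * x = -1) : (σ ^ t) x⁻¹ * x⁻¹ = -1 := by
    rw [map_inv₀, ← mul_inv, hx, inv_neg, inv_one]
  have main := RankMetric.codeEquiv_iff hodd hord ht hσ hdim hh hk
  refine ⟨?_, ?_, fun hev ↦ ?_, fun hev ↦ ?_⟩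
  · refine main _ 1 1 (.inl rfl) (.inl rfl) id (fun _ _ ↦ rfl) (fun _ hx ↦ hx) (fun x _ ↦ ?_)
      fun _ _ ↦ RankMetric.RightEquiv.refl _
    rw [zpow_one, RankMetric.code_eq_spanCode, RankMetric.psi_eq_signedPsi hord]
    exact RankMetric.RightEquiv.refl _
  · refine main _ (-1) 1 (.inr rfl) (.inl rfl) (·⁻¹) (fun _ _ ↦ map_inv₀ _ _) hinv
      (fun x hx ↦ RankMetric.rightEquiv_code_inv hord hx) fun x hx ↦ ?_
    rcases Nat.even_or_odd t with hev | ho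
    · exact RankMetric.rightEquiv_neg_one_one_of_even hord h2 hx hev
    · exact RankMetric.rightEquiv_neg_left_of_odd hord ho 1 1 x
  · refine main _ 1 (-1) (.inl rfl) (.inr rfl) id (fun _ _ ↦ rfl) (fun _ hx ↦ hx) (fun x hx ↦ ?_)
      fun x hx ↦ (RankMetric.rightEquiv_signed_neg_one_of_even hord (by omega) h2 hx hev).1
    rw [RankMetric.code_zpow_sub_one hord hev hx]
    exact RankMetric.RightEquiv.refl _
  · exact main _ (-1) (-1) (.inr rfl) (.inr rfl) (·⁻¹) (fun _ _ ↦ map_inv₀ _ _) hinv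
      (fun x hx ↦ RankMetric.rightEquiv_code_zpow_add_one hord hev hx)
      fun x hx ↦ (RankMetric.rightEquiv_signed_neg_one_of_even hord (by omega) h2 hx hev).2
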